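/- Let $\mathbf k$ be a field, let $1\le k\le r$, let $R=\mathbf k[x_1,\dots,x_r]$, and let $I_{k,r}\subseteq R$ be the $k$-out-of-$r$ ideal, i.e. the ideal generated by all products of $k$ different variables. Then a (multigraded) minimal free resolution of $I_{k,r}$ is $$\mathbf I_{k,r}:\quad 0\longrightarrow F_{r-k}\stackrel{\partial}{\longrightarrow}\cdots\stackrel{\partial}{\longrightarrow}F_1\stackrel{\partial}{\longrightarrow}F_0\stackrel{\varepsilon}{\longrightarrow}I_{k,r}\longrightarrow 0,$$ where: 1. $F_i$ is the free $R$-module whose basis consists of the symbols $[\sigma,\tau]$ with $\sigma,\tau\subseteq\{1,\dots,r\}$, $\sigma\cap\tau=\emptyset$, $|\sigma|=k$, $|\tau|=i$ and $\max(\sigma)>\max(\tau)$ (with $\max(\emptyset)=-\infty$). The symbol $[\sigma,\tau]$ has multidegree $\sigma\cup\tau$, and there are no such symbols for $i>r-k$. 2. The augmentation is $\varepsilon([\sigma,\emptyset])=\prod_{j\in\sigma}x_j$. For $\tau\ne\emptyset$, write $\operatorname{sgn}(j,\tau)=|\{l\in\tau: l>j\}|$. The differential is $$\partial([\sigma,\tau])=\sum_{j\in\tau}(-1)^{\operatorname{sgn}(j,\tau)}\bigl(-x_j[\sigma,\tau-j]+x_{\max(\sigma)}[\sigma-\max(\sigma)+j,\tau-j]\bigr)$$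 if $\max(\tau)<\max(\sigma-\max(\sigma))$, and $$\partial([\sigma,\tau])=\sum_{j\in\tau}(-1)^{\operatorname{sgn}(j,\tau)}\bigl(-x_j[\sigma,\tau-j]\bigr)+x_{\max(\sigma)}[\sigma-\max(\sigma)+\max(\tau),\tau-\max(\tau)]$$ if $\max(\tau)>\max(\sigma-\max(\sigma))$. In the first case $\partial([\sigma,\tau])$ has $2|\tau|$ nonzero summands (with respect to the basis of $F_{|\tau|-1}$), in the second case only $|\tau|+1$. Here "minimal free resolution" means that the $F_i$ are free of finite rank, the displayed sequence is exact, its maps are homogeneous of multidegree $0$, and $\partial(F_{i+1})\subseteq(x_1,\dots,x_r)F_i$ for all $i\ge 0$. -/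

import Mathlib

namespace KOutOf

open MvPolynomial

/-- The `k`-out-of-`r` ideal: the ideal of `K[x_1, …, x_r]` generated by all products of `k`
different variables. The variables are indexed by `Fin r`, with its usual order. -/
noncomputable def ideal (K : Type*) [Field K] (k r : ℕ) : Ideal (MvPolynomial (Fin r) K) :=
  Ideal.span {m | ∃ σ : Finset (Fin r), σ.card = k ∧ m = ∏ j ∈ σ, X j}

/-- The condition on a pair `(σ, τ)` to label a generator of `F_i`. Here `Finset.max` takes values
in `WithBot (Fin r)`, so that the maximum of the empty set lies below every index. -/
def IsLabel {r : ℕ} (k i : ℕ) (σ τ : Finset (Fin r)) : Prop :=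
  Disjoint σ τ ∧ σ.card = k ∧ τ.card = i ∧ τ.max < σ.max

/-- The labels `[σ, τ]` of the generators of `F_i`. -/
structure Label (r k i : ℕ) where
  /-- The first set, of size `k`. -/
  σ : Finset (Fin r)
  /-- The second set, of size `i`. -/
  τ : Finset (Fin r)
  isLabel : IsLabel k i σ τ

theorem Label.σ_nonempty {r k i : ℕ} (p : Label r k i) : p.σ.Nonempty := by
  rw [Finset.nonempty_iff_ne_empty]
  intro h
  have := p.isLabel.2.2.2
  simp [h] at this

theorem Label.τ_nonempty {r k i : ℕ} (p : Label r k (i + 1)) : p.τ.Nonempty := by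
  rw [← Finset.card_pos, p.isLabel.2.2.1]
  exact Nat.succ_pos i

/-- The largest element of `σ`. -/
def Label.maxσ {r k i : ℕ} (p : Label r k i) : Fin r := p.σ.max' p.σ_nonempty

/-- The largest element of a nonempty `τ`. -/
def Label.maxτ {r k i : ℕ} (p : Label r k (i + 1)) : Fin r := p.τ.max' p.τ_nonempty

/-- The first of the two cases for the differential: `max τ < max (σ - max σ)`. -/
def Label.FirstCase {r k i : ℕ} (p : Label r k i) : Prop :=
  p.τ.max < (p.σ.erase p.maxσ).max

/-- The second of the two cases for the differential: `max τ > max (σ - max σ)`, which holds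
also if `σ - max σ` is empty and `τ` is not. -/
def Label.SecondCase {r k i : ℕ} (p : Label r k i) : Prop :=
  (p.σ.erase p.maxσ).max < p.τ.max

/-- The multidegree of the generator `[σ, τ]`: the exponent vector of `∏ j ∈ σ ∪ τ, x_j`. -/
noncomputable def Label.deg {r k i : ℕ} (p : Label r k i) : Fin r →₀ ℕ :=
  ∑ j ∈ p.σ ∪ p.τ, Finsupp.single j 1

/-- The free module `F_i` on the labels `[σ, τ]` with `|τ| = i`. -/
abbrev FreeMod (K : Type*) [Field K] (r k i : ℕ) : Type _ :=
  Label r k i →₀ MvPolynomial (Fin r) K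

open Classical in
/-- The generator `[σ, τ]` of `F_i`, with the convention that it is `0` if `(σ, τ)` is not a
label. -/
noncomputable def gen (K : Type*) [Field K] {r : ℕ} (k i : ℕ) (σ τ : Finset (Fin r)) :
    FreeMod K r k i :=
  if h : IsLabel k i σ τ then Finsupp.single ⟨σ, τ, h⟩ 1 else 0

/-- The exponent of the sign attached to `j ∈ τ`: the number of elements of `τ` above `j`. -/
def sgn {r : ℕ} (j : Fin r) (τ : Finset (Fin r)) : ℕ :=
  (τ.filter (fun l => j < l)).card

open Classical in
/-- The value of the differential on the generator `[σ, τ]`, for nonempty `τ`. The maxima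
`max τ` and `max (σ - max σ)` never agree then, so the `else` branch is the second case. -/
noncomputable def boundaryGen (K : Type*) [Field K] {r k i : ℕ} (p : Label r k (i + 1)) :
    FreeMod K r k i :=
  if p.FirstCase then
    ∑ j ∈ p.τ, (-1 : MvPolynomial (Fin r) K) ^ sgn j p.τ •
      (-((X j : MvPolynomial (Fin r) K) • gen K k i p.σ (p.τ.erase j)) +
        (X p.maxσ : MvPolynomial (Fin r) K) •
          gen K k i (insert j (p.σ.erase p.maxσ)) (p.τ.erase j))
  else
    (∑ j ∈ p.τ, (-1 : MvPolynomial (Fin r) K) ^ sgn j p.τ •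
      (-((X j : MvPolynomial (Fin r) K) • gen K k i p.σ (p.τ.erase j)))) +
        (X p.maxσ : MvPolynomial (Fin r) K) •
          gen K k i (insert p.maxτ (p.σ.erase p.maxσ)) (p.τ.erase p.maxτ)

/-- The differential `∂ : F_{i+1} → F_i`. -/
noncomputable def boundary (K : Type*) [Field K] (r k i : ℕ) :
    FreeMod K r k (i + 1) →ₗ[MvPolynomial (Fin r) K] FreeMod K r k i :=
  Finsupp.linearCombination (MvPolynomial (Fin r) K) (boundaryGen K)

/-- The augmentation `F_0 → I_{k,r}`, which sends `[σ, ∅]` to `∏ j ∈ σ, x_j`. -/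
noncomputable def augmentation (K : Type*) [Field K] (r k : ℕ) :
    FreeMod K r k 0 →ₗ[MvPolynomial (Fin r) K] ideal K k r :=
  Finsupp.linearCombination (MvPolynomial (Fin r) K) fun p =>
    (⟨∏ j ∈ p.σ, X j, Ideal.subset_span ⟨p.σ, p.isLabel.2.1, rfl⟩⟩ : ideal K k r)

/-- The complex `⋯ → F_1 → F_0 → I → 0` of free modules `F_i` with bases `ι i` over
`K[x_1, …, x_r]`, whose basis elements have the multidegrees `deg i`, is a (multigraded) minimal
free resolution of the ideal `I`: the `F_i` have finite rank, the complex is exact, all maps are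
homogeneous of multidegree zero, and every differential has image in `(x_1, …, x_r) F_i`. -/
structure IsMinimalFreeResolution {K : Type*} [Field K] {r : ℕ}
    (I : Ideal (MvPolynomial (Fin r) K)) (ι : ℕ → Type*) (deg : ∀ i, ι i → (Fin r →₀ ℕ))
    (d : ∀ i, (ι (i + 1) →₀ MvPolynomial (Fin r) K) →ₗ[MvPolynomial (Fin r) K]
      (ι i →₀ MvPolynomial (Fin r) K))
    (ε : (ι 0 →₀ MvPolynomial (Fin r) K) →ₗ[MvPolynomial (Fin r) K] I) : Prop where
  finite : ∀ i, Finite (ι i)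
  surjective : Function.Surjective ε
  exact_zero : Function.Exact (d 0) ε
  exact_succ : ∀ i, Function.Exact (d (i + 1)) (d i)
  homogeneous_zero : ∀ (p : ι 0) (e : Fin r →₀ ℕ),
    coeff e (ε (Finsupp.single p 1) : MvPolynomial (Fin r) K) ≠ 0 → e = deg 0 p
  homogeneous_succ : ∀ (i : ℕ) (p : ι (i + 1)) (q : ι i) (e : Fin r →₀ ℕ),
    coeff e (d i (Finsupp.single p 1) q) ≠ 0 → e + deg i q = deg (i + 1) p
  minimal : ∀ i, LinearMap.range (d i) ≤
    idealOfVars (Fin r) K • (⊤ : Submodule (MvPolynomial (Fin r) K)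
      (ι i →₀ MvPolynomial (Fin r) K))

end KOutOf

/-!
The complex of the `F_i` is filtered by the weight of `σ`, the sum of its elements: the Koszul part
`[σ, τ] ↦ ∑ ± x_j [σ, τ - j]` of the differential preserves `σ`, and the exchange part, which
replaces `max σ` by a smaller `j ∈ τ`, lowers the weight (`Label.weight_exchange_lt`). On the graded
pieces one sees, for each `σ`, the Koszul complex on the variables `x_j` with `j ∉ σ` and
`j < max σ`. These Koszul complexes are exact in positive degrees, and their homology in degree zero
has as a basis the monomials without such variables. Every monomial in the ideal is in a unique way
`x^a x_σ` with `x^a` of this kind, namely with `σ` the set of the `k` smallest variables that divide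
it (`Label.eq_of_reduced`). This is why the complex resolves the ideal.

In place of spectral sequences or iterated mapping cones, the proof uses the usual contraction of
the Koszul complex by its largest available variable, in the form of a normal form. A term
`x^a [σ, τ]` is called `Reduced` if the largest of the indices in `τ` and of those `j ∉ σ` with
`j < max σ` and `x_j ∣ x^a` lies in `τ`, or if there are no such indices. Then

* every element is reduced modulo boundaries (`exists_boundary_add_reduced`), by induction on the
  weight;
* the differential and the augmentation are injective on reduced elements
  (`eq_zero_of_boundary_eq_zero`, `eq_zero_of_augmentation_eq_zero`), as one sees from the
  coefficient of a leading term.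

Together with `∂ ∘ ∂ = 0` and `ε ∘ ∂ = 0` this gives exactness. That `∂ ∘ ∂ = 0` is an
antisymmetry in the two removed indices, once the two cases of the differential are written as one
sum (`boundaryGen_eq_sum`). The number of summands, homogeneity and minimality are read off from the
coefficients of the differential.
-/

namespace KOutOf

open MvPolynomial

/-! ### Labels and their maxima -/

theorem max_lt_max_iff {α : Type*} [LinearOrder α] {s t : Finset α} :
    t.max < s.max ↔ ∃ m ∈ s, ∀ l ∈ t, l < m := by
  constructor
  · intro h
    have hs : s.Nonempty := by
      rw [Finset.nonempty_iff_ne_empty]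
      rintro rfl
      simp at h
    refine ⟨s.max' hs, s.max'_mem hs, fun l hl => ?_⟩
    have h1 : (l : WithBot α) < (s.max' hs : α) := by
      rw [Finset.coe_max']
      exact (Finset.le_max hl).trans_lt h
    exact_mod_cast h1
  · rintro ⟨m, hm, h⟩
    refine lt_of_lt_of_le ?_ (Finset.le_max hm)
    rw [Finset.max_eq_sup_withBot, Finset.sup_lt_iff (WithBot.bot_lt_coe m)]
    exact fun l hl => by exact_mod_cast h l hl

theorem isLabel_iff {r k i : ℕ} {σ τ : Finset (Fin r)} :
    IsLabel k i σ τ ↔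
      Disjoint σ τ ∧ σ.card = k ∧ τ.card = i ∧ ∃ m ∈ σ, ∀ l ∈ τ, l < m := by
  rw [IsLabel, max_lt_max_iff]

theorem Label.ext_sets {r k i : ℕ} {p q : Label r k i} (h1 : p.σ = q.σ) (h2 : p.τ = q.τ) :
    p = q := by
  cases p; cases q; simp_all

theorem Label.finite (r k i : ℕ) : Finite (Label r k i) :=
  Finite.of_injective (fun p : Label r k i => (p.σ, p.τ)) fun p q h => by
    simp only [Prod.mk.injEq] at h
    exact Label.ext_sets h.1 h.2

theorem Label.isEmpty_of_lt {r k i : ℕ} (hi : r - k < i) : IsEmpty (Label r k i) := by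
  refine ⟨fun p => ?_⟩
  obtain ⟨h1, h2, h3, -⟩ := p.isLabel
  have h4 := Finset.card_le_univ (p.σ ∪ p.τ)
  rw [Finset.card_union_of_disjoint h1, h2, h3, Fintype.card_fin] at h4
  omega

section Label

variable {r k i : ℕ} (p : Label r k i)

theorem Label.maxσ_mem : p.maxσ ∈ p.σ := Finset.max'_mem _ _

theorem Label.le_maxσ {j : Fin r} (hj : j ∈ p.σ) : j ≤ p.maxσ := Finset.le_max' _ _ hj

theorem Label.lt_maxσ {j : Fin r} (hj : j ∈ p.τ) : j < p.maxσ := by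
  obtain ⟨-, -, -, m, hm, h⟩ := isLabel_iff.1 p.isLabel
  exact (h j hj).trans_le (p.le_maxσ hm)

theorem Label.notMem_σ {j : Fin r} (hj : j ∈ p.τ) : j ∉ p.σ :=
  fun h => Finset.disjoint_left.1 p.isLabel.1 h hj

theorem Label.maxσ_eq {m : Fin r} (hm : m ∈ p.σ) (h : ∀ s ∈ p.σ, s ≤ m) : p.maxσ = m :=
  le_antisymm (h _ p.maxσ_mem) (p.le_maxσ hm)

theorem Label.firstCase_iff :
    p.FirstCase ↔ ∃ m ∈ p.σ.erase p.maxσ, ∀ l ∈ p.τ, l < m := max_lt_max_iff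

end Label

theorem Label.maxτ_mem {r k i : ℕ} (p : Label r k (i + 1)) : p.maxτ ∈ p.τ :=
  Finset.max'_mem _ _

theorem Label.le_maxτ {r k i : ℕ} (p : Label r k (i + 1)) {j : Fin r} (hj : j ∈ p.τ) :
    j ≤ p.maxτ := Finset.le_max' _ _ hj

theorem Label.le_maxτ_of_not_firstCase {r k i : ℕ} (p : Label r k (i + 1)) (h : ¬ p.FirstCase)
    {s : Fin r} (hs : s ∈ p.σ.erase p.maxσ) : s ≤ p.maxτ := by
  rw [p.firstCase_iff] at h
  push Not at h
  obtain ⟨l, hl, hl'⟩ := h s hs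
  exact hl'.trans (p.le_maxτ hl)

theorem Label.card_exchange {r k i : ℕ} (p : Label r k i) {j : Fin r} (hj : j ∈ p.τ) :
    (insert j (p.σ.erase p.maxσ)).card = k := by
  rw [Finset.card_insert_of_notMem fun h => p.notMem_σ hj (Finset.mem_of_mem_erase h),
    Finset.card_erase_add_one p.maxσ_mem, p.isLabel.2.1]

theorem Label.isLabel_erase {r k i : ℕ} (p : Label r k (i + 1)) {j : Fin r} (hj : j ∈ p.τ) :
    IsLabel k i p.σ (p.τ.erase j) := by
  refine isLabel_iff.2 ⟨p.isLabel.1.mono_right (Finset.erase_subset _ _), p.isLabel.2.1, ?_,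
    p.maxσ, p.maxσ_mem, fun l hl => p.lt_maxσ (Finset.mem_of_mem_erase hl)⟩
  rw [Finset.card_erase_of_mem hj, p.isLabel.2.2.1, Nat.add_sub_cancel]

theorem Label.disjoint_exchange {r k i : ℕ} (p : Label r k i) (j : Fin r) :
    Disjoint (insert j (p.σ.erase p.maxσ)) (p.τ.erase j) := by
  rw [Finset.disjoint_insert_left]
  exact ⟨Finset.notMem_erase _ _,
    p.isLabel.1.mono (Finset.erase_subset _ _) (Finset.erase_subset _ _)⟩

/-- The exchange `[σ - max σ + j, τ - j]` is a label for every `j ∈ τ` in the first case, and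
only for `j = max τ` in the second. -/
theorem Label.isLabel_exchange_iff {r k i : ℕ} (p : Label r k (i + 1)) {j : Fin r}
    (hj : j ∈ p.τ) :
    IsLabel k i (insert j (p.σ.erase p.maxσ)) (p.τ.erase j) ↔ p.FirstCase ∨ j = p.maxτ := by
  constructor
  · intro h
    obtain ⟨-, -, -, m, hm, h⟩ := isLabel_iff.1 h
    by_contra hcon
    push Not at hcon
    have h1 := h _ (Finset.mem_erase.2 ⟨hcon.2.symm, p.maxτ_mem⟩)
    rcases Finset.mem_insert.1 hm with rfl | hm
    · exact absurd (p.le_maxτ hj) (not_le.2 h1)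
    · exact absurd (p.le_maxτ_of_not_firstCase hcon.1 hm) (not_le.2 h1)
  · intro h
    refine isLabel_iff.2 ⟨p.disjoint_exchange j, p.card_exchange hj,
      (p.isLabel_erase hj).2.2.1, ?_⟩
    rcases h with h | rfl
    · obtain ⟨m, hm, h⟩ := p.firstCase_iff.1 h
      exact ⟨m, Finset.mem_insert_of_mem hm, fun l hl => h l (Finset.mem_of_mem_erase hl)⟩
    · refine ⟨_, Finset.mem_insert_self _ _, fun l hl => ?_⟩
      rw [Finset.mem_erase] at hl
      exact lt_of_le_of_ne (p.le_maxτ hl.2) hl.1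

/-! ### The differential as a single sum -/

section Gen

variable (K : Type*) [Field K] {r k i : ℕ}

theorem gen_of_isLabel {σ τ : Finset (Fin r)} (h : IsLabel k i σ τ) :
    gen K k i σ τ = Finsupp.single ⟨σ, τ, h⟩ 1 := by
  rw [gen, dif_pos h]

theorem gen_of_not_isLabel {σ τ : Finset (Fin r)} (h : ¬ IsLabel k i σ τ) :
    gen K k i σ τ = 0 := by
  rw [gen, dif_neg h]

theorem gen_label (p : Label r k i) : gen K k i p.σ p.τ = Finsupp.single p 1 :=
  gen_of_isLabel K p.isLabel

theorem gen_apply (σ τ : Finset (Fin r)) (q : Label r k i) :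
    gen K k i σ τ q = if q.σ = σ ∧ q.τ = τ then 1 else 0 := by
  classical
  by_cases h : IsLabel k i σ τ
  · rw [gen_of_isLabel K h, Finsupp.single_apply]
    refine if_congr ⟨?_, ?_⟩ rfl rfl
    · rintro rfl
      exact ⟨rfl, rfl⟩
    · rintro ⟨h1, h2⟩
      exact Label.ext_sets h1.symm h2.symm
  · rw [gen_of_not_isLabel K h, if_neg]
    · rfl
    · rintro ⟨rfl, rfl⟩
      exact h q.isLabel

theorem sgn_maxτ (p : Label r k (i + 1)) : sgn p.maxτ p.τ = 0 := by
  rw [sgn, Finset.card_eq_zero, Finset.filter_eq_empty_iff]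
  exact fun l hl => not_lt.2 (p.le_maxτ hl)

/-- Both cases of the differential are the same sum, because the superfluous exchange terms of
the second case are indexed by pairs that are not labels. -/
theorem boundaryGen_eq_sum (p : Label r k (i + 1)) :
    boundaryGen K p = ∑ j ∈ p.τ, (-1 : MvPolynomial (Fin r) K) ^ sgn j p.τ •
      (-((X j : MvPolynomial (Fin r) K) • gen K k i p.σ (p.τ.erase j)) +
        (X p.maxσ : MvPolynomial (Fin r) K) •
          gen K k i (insert j (p.σ.erase p.maxσ)) (p.τ.erase j)) := by
  rw [boundaryGen]
  split_ifs with h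
  · rfl
  · simp only [smul_add, Finset.sum_add_distrib]
    congr 1
    rw [Finset.sum_eq_single_of_mem p.maxτ p.maxτ_mem]
    · rw [sgn_maxτ, pow_zero, one_smul]
    · intro j hj hne
      rw [gen_of_not_isLabel, smul_zero, smul_zero]
      rw [p.isLabel_exchange_iff hj]
      simp [h, hne]

theorem boundary_single (p : Label r k (i + 1)) (f : MvPolynomial (Fin r) K) :
    boundary K r k i (Finsupp.single p f) = f • boundaryGen K p := by
  rw [boundary, Finsupp.linearCombination_single]

theorem boundary_gen {σ τ : Finset (Fin r)} (h : IsLabel k (i + 1) σ τ) {m : Fin r}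
    (hm : m ∈ σ) (hmax : ∀ s ∈ σ, s ≤ m) :
    boundary K r k i (gen K k (i + 1) σ τ) =
      ∑ j ∈ τ, (-1 : MvPolynomial (Fin r) K) ^ sgn j τ •
        (-((X j : MvPolynomial (Fin r) K) • gen K k i σ (τ.erase j)) +
          (X m : MvPolynomial (Fin r) K) •
            gen K k i (insert j (σ.erase m)) (τ.erase j)) := by
  rw [gen_of_isLabel K h, boundary_single, one_smul, boundaryGen_eq_sum,
    Label.maxσ_eq ⟨σ, τ, h⟩ hm hmax]

/-! ### Coefficients of the differential -/

theorem boundaryGen_apply (p : Label r k (i + 1)) (q : Label r k i) :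
    boundaryGen K p q = ∑ j ∈ p.τ, (-1 : MvPolynomial (Fin r) K) ^ sgn j p.τ *
      (-((X j : MvPolynomial (Fin r) K) *
          if q.σ = p.σ ∧ q.τ = p.τ.erase j then 1 else 0) +
        (X p.maxσ : MvPolynomial (Fin r) K) *
          if q.σ = insert j (p.σ.erase p.maxσ) ∧ q.τ = p.τ.erase j then 1 else 0) := by
  rw [boundaryGen_eq_sum, Finsupp.finsetSum_apply]
  simp only [Finsupp.smul_apply, Finsupp.add_apply, Finsupp.neg_apply, gen_apply, smul_eq_mul]

theorem Label.σ_ne_exchange (p : Label r k i) {j : Fin r} (hj : j ∈ p.τ) :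
    p.σ ≠ insert j (p.σ.erase p.maxσ) := by
  intro h
  exact p.notMem_σ hj (h ▸ Finset.mem_insert_self _ _)

theorem boundaryGen_apply_erase {p : Label r k (i + 1)} {q : Label r k i} {j : Fin r}
    (hj : j ∈ p.τ) (h1 : q.σ = p.σ) (h2 : q.τ = p.τ.erase j) :
    boundaryGen K p q = (-1) ^ sgn j p.τ * -X j := by
  rw [boundaryGen_apply, Finset.sum_eq_single_of_mem j hj]
  · rw [if_pos ⟨h1, h2⟩, if_neg fun h => p.σ_ne_exchange hj (h1.symm.trans h.1)]
    simp
  · intro l hl hne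
    rw [if_neg fun h => hne ((Finset.erase_injOn p.τ) hl hj (h.2.symm.trans h2)),
      if_neg fun h => hne ((Finset.erase_injOn p.τ) hl hj (h.2.symm.trans h2))]
    simp

theorem boundaryGen_apply_exchange {p : Label r k (i + 1)} {q : Label r k i} {j : Fin r}
    (hj : j ∈ p.τ) (h1 : q.σ = insert j (p.σ.erase p.maxσ)) (h2 : q.τ = p.τ.erase j) :
    boundaryGen K p q = (-1) ^ sgn j p.τ * X p.maxσ := by
  rw [boundaryGen_apply, Finset.sum_eq_single_of_mem j hj]
  · rw [if_neg fun h => p.σ_ne_exchange hj (h.1.symm.trans h1), if_pos ⟨h1, h2⟩]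
    simp
  · intro l hl hne
    rw [if_neg fun h => hne ((Finset.erase_injOn p.τ) hl hj (h.2.symm.trans h2)),
      if_neg fun h => hne ((Finset.erase_injOn p.τ) hl hj (h.2.symm.trans h2))]
    simp

theorem exists_of_boundaryGen_apply_ne_zero {p : Label r k (i + 1)} {q : Label r k i}
    (h : boundaryGen K p q ≠ 0) :
    ∃ j ∈ p.τ, q.τ = p.τ.erase j ∧ (q.σ = p.σ ∨ q.σ = insert j (p.σ.erase p.maxσ)) := by
  by_contra hcon
  push Not at hcon
  refine h ?_
  rw [boundaryGen_apply]
  refine Finset.sum_eq_zero fun j hj => ?_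
  rw [if_neg fun h => (hcon j hj h.2).1 h.1, if_neg fun h => (hcon j hj h.2).2 h.1]
  simp

theorem neg_one_pow_mul_ne_zero (n : ℕ) {f : MvPolynomial (Fin r) K} (hf : f ≠ 0) :
    (-1) ^ n * f ≠ 0 :=
  mul_ne_zero (pow_ne_zero _ (neg_ne_zero.2 one_ne_zero)) hf

theorem coeff_neg_one_pow_mul (n : ℕ) (f : MvPolynomial (Fin r) K) (e : Fin r →₀ ℕ) :
    coeff e ((-1) ^ n * f) = (-1) ^ n * coeff e f := by
  rcases neg_one_pow_eq_or (MvPolynomial (Fin r) K) n with h | h <;>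
  rcases neg_one_pow_eq_or K n with h' | h' <;>
  rcases Nat.even_or_odd n with hn | hn <;> simp [hn.neg_one_pow]

/-- The summands of the differential belong to different generators, so that it suffices to count
the exchanges that are labels. -/
theorem card_support_boundaryGen (p : Label r k (i + 1)) (T : Finset (Fin r)) (hT : T ⊆ p.τ)
    (h : ∀ j ∈ p.τ, j ∈ T ↔ IsLabel k i (insert j (p.σ.erase p.maxσ)) (p.τ.erase j)) :
    (boundaryGen K p).support.card = p.τ.card + T.card := by
  classical
  have hinj : Function.Injective (fun q : Label r k i => (q.σ, q.τ)) := fun q q' hq => by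
    simp only [Prod.mk.injEq] at hq
    exact Label.ext_sets hq.1 hq.2
  have hE : Set.InjOn (fun j => (p.σ, p.τ.erase j)) p.τ := fun j hj l hl hjl =>
    (Finset.erase_injOn p.τ) hj hl (Prod.mk.inj hjl).2
  have hX : Set.InjOn (fun j => (insert j (p.σ.erase p.maxσ), p.τ.erase j)) T :=
    fun j hj l hl hjl => (Finset.erase_injOn p.τ) (hT hj) (hT hl) (Prod.mk.inj hjl).2
  rw [← Finset.card_image_of_injective _ hinj, ← Finset.card_image_of_injOn hE,
    ← Finset.card_image_of_injOn hX, ← Finset.card_union_of_disjoint]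
  · congr 1
    ext ⟨s, t⟩
    simp only [Finset.mem_image, Finset.mem_union, Finsupp.mem_support_iff, Prod.mk.injEq]
    constructor
    · rintro ⟨q, hq, rfl, rfl⟩
      obtain ⟨j, hj, h2, h1 | h1⟩ := exists_of_boundaryGen_apply_ne_zero K hq
      · exact Or.inl ⟨j, hj, h1.symm, h2.symm⟩
      · exact Or.inr ⟨j, (h j hj).2 (h1 ▸ h2 ▸ q.isLabel), h1.symm, h2.symm⟩
    · rintro (⟨j, hj, rfl, rfl⟩ | ⟨j, hj, rfl, rfl⟩)
      · refine ⟨⟨_, _, p.isLabel_erase hj⟩, ?_, rfl, rfl⟩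
        rw [boundaryGen_apply_erase K hj rfl rfl]
        exact neg_one_pow_mul_ne_zero K _ (neg_ne_zero.2 (X_ne_zero j))
      · refine ⟨⟨_, _, (h j (hT hj)).1 hj⟩, ?_, rfl, rfl⟩
        rw [boundaryGen_apply_exchange K (hT hj) rfl rfl]
        exact neg_one_pow_mul_ne_zero K _ (X_ne_zero _)
  · rw [Finset.disjoint_left]
    simp only [Finset.mem_image]
    rintro _ ⟨j, hj, rfl⟩ ⟨l, hl, hjl⟩
    exact p.σ_ne_exchange (hT hl) (Prod.mk.inj hjl).1.symm

theorem card_support_of_firstCase (p : Label r k (i + 1)) (h : p.FirstCase) :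
    (boundaryGen K p).support.card = 2 * p.τ.card := by
  rw [card_support_boundaryGen K p p.τ subset_rfl, two_mul]
  intro j hj
  simp [p.isLabel_exchange_iff hj, h, hj]

theorem card_support_of_secondCase (p : Label r k (i + 1)) (h : p.SecondCase) :
    (boundaryGen K p).support.card = p.τ.card + 1 := by
  have h' : ¬ p.FirstCase := fun h1 => lt_asymm (a := p.τ.max) h1 h
  rw [card_support_boundaryGen K p {p.maxτ} (by simpa using p.maxτ_mem), Finset.card_singleton]
  intro j hj
  simp [p.isLabel_exchange_iff hj, h']

/-! ### Homogeneity and minimality -/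

theorem single_add_deg_erase {p : Label r k (i + 1)} {q : Label r k i} {j : Fin r}
    (hj : j ∈ p.τ) (h1 : q.σ = p.σ) (h2 : q.τ = p.τ.erase j) :
    Finsupp.single j 1 + q.deg = p.deg := by
  have h : p.σ ∪ p.τ.erase j = (p.σ ∪ p.τ).erase j := by
    rw [Finset.erase_union_distrib, Finset.erase_eq_of_notMem (p.notMem_σ hj)]
  rw [Label.deg, Label.deg, h1, h2, h]
  exact Finset.add_sum_erase (p.σ ∪ p.τ) (fun j => Finsupp.single j 1)
    (Finset.mem_union_right _ hj)

theorem single_add_deg_exchange {p : Label r k (i + 1)} {q : Label r k i} {j : Fin r}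
    (hj : j ∈ p.τ) (h1 : q.σ = insert j (p.σ.erase p.maxσ)) (h2 : q.τ = p.τ.erase j) :
    Finsupp.single p.maxσ 1 + q.deg = p.deg := by
  have h : insert j (p.σ.erase p.maxσ) ∪ p.τ.erase j = (p.σ ∪ p.τ).erase p.maxσ := by
    rw [Finset.insert_union, ← Finset.union_insert, Finset.insert_erase hj,
      Finset.erase_union_distrib,
      Finset.erase_eq_of_notMem (a := p.maxσ) fun h => p.notMem_σ h p.maxσ_mem]
  rw [Label.deg, Label.deg, h1, h2, h]
  exact Finset.add_sum_erase (p.σ ∪ p.τ) (fun j => Finsupp.single j 1)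
    (Finset.mem_union_left _ p.maxσ_mem)

theorem boundaryGen_homogeneous (p : Label r k (i + 1)) (q : Label r k i) (e : Fin r →₀ ℕ)
    (he : coeff e (boundaryGen K p q) ≠ 0) : e + q.deg = p.deg := by
  classical
  have h : boundaryGen K p q ≠ 0 := fun h => he (by rw [h, coeff_zero])
  obtain ⟨j, hj, h2, h1 | h1⟩ := exists_of_boundaryGen_apply_ne_zero K h
  · rw [boundaryGen_apply_erase K hj h1 h2, coeff_neg_one_pow_mul, coeff_neg, coeff_X] at he
    rw [← single_add_deg_erase hj h1 h2]
    by_cases h3 : Finsupp.single j 1 = e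
    · rw [h3]
    · simp [h3] at he
  · rw [boundaryGen_apply_exchange K hj h1 h2, coeff_neg_one_pow_mul, coeff_X] at he
    rw [← single_add_deg_exchange hj h1 h2]
    by_cases h3 : Finsupp.single p.maxσ 1 = e
    · rw [h3]
    · simp [h3] at he

variable (r k i) in
theorem range_boundary_le :
    LinearMap.range (boundary K r k i) ≤
      idealOfVars (Fin r) K • (⊤ : Submodule (MvPolynomial (Fin r) K) (FreeMod K r k i)) := by
  have hX : ∀ (j : Fin r) (x : FreeMod K r k i), (X j : MvPolynomial (Fin r) K) • x ∈
      idealOfVars (Fin r) K • (⊤ : Submodule (MvPolynomial (Fin r) K) (FreeMod K r k i)) :=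
    fun j x => Submodule.smul_mem_smul (Ideal.subset_span ⟨j, rfl⟩) trivial
  rw [boundary, Finsupp.range_linearCombination, Submodule.span_le]
  rintro _ ⟨p, rfl⟩
  rw [SetLike.mem_coe, boundaryGen_eq_sum]
  exact Submodule.sum_mem _ fun j _ => Submodule.smul_mem _ _
    (Submodule.add_mem _ (Submodule.neg_mem _ (hX _ _)) (hX _ _))

end Gen

/-! ### The differential squares to zero -/

theorem sgn_eq_sgn_erase {r : ℕ} {τ : Finset (Fin r)} {j l : Fin r} (hl : l ∈ τ) :
    sgn j τ = sgn j (τ.erase l) + if j < l then 1 else 0 := by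
  rw [sgn, sgn, Finset.filter_erase]
  split_ifs with h
  · rw [Finset.card_erase_add_one (Finset.mem_filter.2 ⟨hl, h⟩)]
  · rw [Finset.erase_eq_of_notMem fun h' => h (Finset.mem_filter.1 h').2, add_zero]

theorem neg_one_pow_sgn_mul {R : Type*} [CommRing R] {r : ℕ} {τ : Finset (Fin r)} {j l : Fin r}
    (hj : j ∈ τ) (hl : l ∈ τ) (hne : j ≠ l) :
    (-1 : R) ^ sgn j τ * (-1) ^ sgn l (τ.erase j) =
      -((-1) ^ sgn l τ * (-1) ^ sgn j (τ.erase l)) := by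
  rw [sgn_eq_sgn_erase (j := j) hl, sgn_eq_sgn_erase (j := l) hj]
  rcases lt_or_gt_of_ne hne with h | h
  · rw [if_pos h, if_neg (not_lt.2 h.le)]
    ring
  · rw [if_neg (not_lt.2 h.le), if_pos h]
    ring

/-- The mechanism behind `∂ ∘ ∂ = 0` in a Koszul complex: the terms for `(j, l)` and `(l, j)`
cancel. -/
theorem sum_sum_erase_eq_zero {R M : Type*} [CommRing R] [AddCommGroup M] [Module R M] {r : ℕ}
    (τ : Finset (Fin r)) (B : Fin r → Fin r → M) (hB : ∀ j l, B j l = B l j) :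
    ∑ j ∈ τ, ∑ l ∈ τ.erase j, (-1 : R) ^ sgn j τ • (-1 : R) ^ sgn l (τ.erase j) • B j l = 0 := by
  rw [Finset.sum_sigma']
  refine Finset.sum_involution (fun x _ => ⟨x.2, x.1⟩) ?_ ?_ ?_ ?_
  · rintro ⟨j, l⟩ h
    simp only [Finset.mem_sigma, Finset.mem_erase] at h
    simp only [smul_smul]
    rw [neg_one_pow_sgn_mul h.1 h.2.2 h.2.1.symm, hB l j, ← add_smul, neg_add_cancel, zero_smul]
  · rintro ⟨j, l⟩ h - heq
    simp only [Finset.mem_sigma, Finset.mem_erase] at h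
    simp only [Sigma.mk.injEq] at heq
    exact h.2.1 heq.1
  · rintro ⟨j, l⟩ h
    simp only [Finset.mem_sigma, Finset.mem_erase] at h ⊢
    exact ⟨h.2.2, h.2.1.symm, h.1⟩
  · rintro ⟨j, l⟩ -
    rfl

section

variable (K : Type*) [Field K] {r k i : ℕ}

/-- In the alternating sum of the boundaries of all exchanges, the exchange parts cancel. In the
first case they are symmetric in the two exchanged indices; in the second case only the exchange
of `max τ` is a label, and its exchange part accounts for the Koszul parts of the pairs that are
not labels. -/
theorem sum_boundary_exchange (p : Label r k (i + 2)) :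
    ∑ j ∈ p.τ, (-1 : MvPolynomial (Fin r) K) ^ sgn j p.τ •
      boundary K r k i (gen K k (i + 1) (insert j (p.σ.erase p.maxσ)) (p.τ.erase j)) =
    ∑ j ∈ p.τ, ∑ l ∈ p.τ.erase j, (-1 : MvPolynomial (Fin r) K) ^ sgn j p.τ •
      (-1 : MvPolynomial (Fin r) K) ^ sgn l (p.τ.erase j) •
        -((X l : MvPolynomial (Fin r) K) •
          gen K k i (insert j (p.σ.erase p.maxσ)) ((p.τ.erase j).erase l)) := by
  set ρ := p.σ.erase p.maxσ with hρ
  by_cases hp : p.FirstCase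
  · obtain ⟨m, hm, hlt⟩ := p.firstCase_iff.1 hp
    rw [← hρ] at hm
    set n := ρ.max' ⟨m, hm⟩ with hn
    have hnρ : n ∈ ρ := Finset.max'_mem _ _
    have hlt' : ∀ l ∈ p.τ, l < n := fun l hl => (hlt l hl).trans_le (Finset.le_max' _ _ hm)
    rw [← sub_eq_zero, ← Finset.sum_sub_distrib]
    rw [← sum_sum_erase_eq_zero (R := MvPolynomial (Fin r) K) p.τ (fun j l =>
      (X n : MvPolynomial (Fin r) K) •
        gen K k i (insert l (insert j (ρ.erase n))) ((p.τ.erase j).erase l))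
      (fun j l => by rw [Finset.insert_comm, Finset.erase_right_comm (s := p.τ)])]
    refine Finset.sum_congr rfl fun j hj => ?_
    rw [boundary_gen K ((p.isLabel_exchange_iff hj).2 (Or.inl hp))
      (Finset.mem_insert_of_mem hnρ) (fun s hs => ?_), Finset.smul_sum, ← Finset.sum_sub_distrib]
    · refine Finset.sum_congr rfl fun l hl => ?_
      rw [Finset.erase_insert_of_ne (hlt' j hj).ne, smul_add, smul_add, add_sub_cancel_left]
    · rcases Finset.mem_insert.1 hs with rfl | hs
      · exact (hlt' s hj).le
      · exact Finset.le_max' _ _ hs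
  · set t := p.maxτ with ht
    have htτ : t ∈ p.τ := p.maxτ_mem
    have htρ : t ∉ ρ := fun h => p.notMem_σ htτ (Finset.mem_of_mem_erase h)
    rw [← Finset.add_sum_erase _ _ htτ, ← Finset.add_sum_erase (a := t) p.τ
      (fun j => ∑ l ∈ p.τ.erase j, _) htτ, Finset.sum_eq_zero (s := p.τ.erase t), add_zero]
    · rw [boundary_gen K ((p.isLabel_exchange_iff htτ).2 (Or.inr rfl))
        (Finset.mem_insert_self _ _) (fun s hs => ?_), Finset.smul_sum]
      · simp only [smul_add, Finset.sum_add_distrib]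
        congr 1
        refine Finset.sum_congr rfl fun j hj => ?_
        have hj' := Finset.mem_erase.1 hj
        rw [Finset.sum_eq_single_of_mem t (Finset.mem_erase.2 ⟨hj'.1.symm, htτ⟩)]
        · rw [Finset.erase_insert htρ, Finset.erase_right_comm (a := j), smul_smul, smul_smul,
            neg_one_pow_sgn_mul htτ hj'.2 hj'.1.symm]
          module
        · intro l hl hlt
          rw [gen_of_not_isLabel, smul_zero, neg_zero, smul_zero, smul_zero]
          -- The index `t` is still in the second set, and nothing in the first one is above it.
          rintro h
          obtain ⟨-, -, -, m, hm, h⟩ := isLabel_iff.1 h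
          have h1 := h t (Finset.mem_erase.2 ⟨hlt.symm, Finset.mem_erase.2 ⟨hj'.1.symm, htτ⟩⟩)
          rcases Finset.mem_insert.1 hm with rfl | hm
          · exact absurd (p.le_maxτ hj'.2) (not_le.2 h1)
          · exact absurd (p.le_maxτ_of_not_firstCase hp hm) (not_le.2 h1)
      · rcases Finset.mem_insert.1 hs with rfl | hs
        · exact le_rfl
        · exact p.le_maxτ_of_not_firstCase hp hs
    · intro j hj
      have hj' := Finset.mem_erase.1 hj
      rw [gen_of_not_isLabel, map_zero, smul_zero]
      rw [p.isLabel_exchange_iff hj'.2]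
      rintro (h | h)
      · exact hp h
      · exact hj'.1 h

theorem boundary_boundaryGen (p : Label r k (i + 2)) :
    boundary K r k i (boundaryGen K p) = 0 := by
  have hexch := sum_boundary_exchange K p
  set ρ := p.σ.erase p.maxσ with hρ
  rw [boundaryGen_eq_sum, map_sum]
  simp only [map_smul, map_add, map_neg]
  rw [← hρ]
  have h1 : ∀ j ∈ p.τ, boundary K r k i (gen K k (i + 1) p.σ (p.τ.erase j)) =
      ∑ l ∈ p.τ.erase j, (-1 : MvPolynomial (Fin r) K) ^ sgn l (p.τ.erase j) •
        (-((X l : MvPolynomial (Fin r) K) • gen K k i p.σ ((p.τ.erase j).erase l)) +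
          (X p.maxσ : MvPolynomial (Fin r) K) •
            gen K k i (insert l ρ) ((p.τ.erase j).erase l)) :=
    fun j hj => boundary_gen K (p.isLabel_erase hj) p.maxσ_mem fun s hs => p.le_maxσ hs
  have h2 := congrArg (fun x => (X p.maxσ : MvPolynomial (Fin r) K) • x) hexch
  simp only [Finset.smul_sum] at h2
  simp only [smul_add, Finset.sum_add_distrib]
  simp only [smul_comm _ (X p.maxσ : MvPolynomial (Fin r) K)] at h2 ⊢
  rw [h2, Finset.sum_congr rfl fun j hj => by rw [h1 j hj], ← Finset.sum_add_distrib]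
  rw [← sum_sum_erase_eq_zero (R := MvPolynomial (Fin r) K) p.τ (fun j l =>
      (X j * X l : MvPolynomial (Fin r) K) • gen K k i p.σ ((p.τ.erase j).erase l) -
      ((X j * X p.maxσ : MvPolynomial (Fin r) K) •
        gen K k i (insert l ρ) ((p.τ.erase j).erase l) +
      (X l * X p.maxσ : MvPolynomial (Fin r) K) •
        gen K k i (insert j ρ) ((p.τ.erase j).erase l)))
      (fun j l => by
        rw [Finset.erase_right_comm, mul_comm (X j) (X l)]
        exact congrArg _ (add_comm _ _))]
  refine Finset.sum_congr rfl fun j hj => ?_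
  rw [← smul_neg, ← Finset.smul_sum, ← Finset.sum_neg_distrib]
  simp only [Finset.smul_sum]
  rw [← Finset.sum_add_distrib]
  refine Finset.sum_congr rfl fun l hl => ?_
  module

theorem boundary_comp_boundary (x : FreeMod K r k (i + 2)) :
    boundary K r k i (boundary K r k (i + 1) x) = 0 := by
  induction x using Finsupp.induction_linear with
  | zero => simp
  | add x y hx hy => rw [map_add, map_add, hx, hy, add_zero]
  | single p f => rw [boundary_single, map_smul, boundary_boundaryGen, smul_zero]

theorem coe_augmentation (x : FreeMod K r k 0) :
    (augmentation K r k x : MvPolynomial (Fin r) K) = x.sum fun p f => f * ∏ j ∈ p.σ, X j := by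
  rw [augmentation, Finsupp.linearCombination_apply, Finsupp.sum, Submodule.coe_sum]
  rfl

theorem augmentation_single (p : Label r k 0) (f : MvPolynomial (Fin r) K) :
    (augmentation K r k (Finsupp.single p f) : MvPolynomial (Fin r) K) = f * ∏ j ∈ p.σ, X j := by
  rw [coe_augmentation, Finsupp.sum_single_index (zero_mul _)]

theorem augmentation_gen {σ : Finset (Fin r)} (h : IsLabel k 0 σ ∅) :
    (augmentation K r k (gen K k 0 σ ∅) : MvPolynomial (Fin r) K) = ∏ j ∈ σ, X j := by
  rw [gen_of_isLabel K h, augmentation_single, one_mul]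

theorem augmentation_comp_boundary (x : FreeMod K r k 1) :
    augmentation K r k (boundary K r k 0 x) = 0 := by
  induction x using Finsupp.induction_linear with
  | zero => simp
  | add x y hx hy => rw [map_add, map_add, hx, hy, add_zero]
  | single p f =>
    rw [boundary_single, map_smul]
    convert smul_zero f
    obtain ⟨t, ht⟩ := Finset.card_eq_one.1 p.isLabel.2.2.1
    have htτ : t ∈ p.τ := by simp [ht]
    have hE := p.isLabel_erase htτ
    have hX := (p.isLabel_exchange_iff htτ).2 (Or.inr (by
      have := p.maxτ_mem
      rw [ht, Finset.mem_singleton] at this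
      exact this.symm))
    rw [boundaryGen_eq_sum, ht, Finset.sum_singleton, map_smul]
    rw [ht, Finset.erase_singleton] at hE hX
    rw [Finset.erase_singleton]
    convert smul_zero _
    rw [← Subtype.coe_inj]
    simp only [map_add, map_neg, map_smul, Submodule.coe_add, Submodule.coe_neg,
      Submodule.coe_smul, augmentation_gen K hE, augmentation_gen K hX, smul_eq_mul,
      ZeroMemClass.coe_zero]
    rw [Finset.prod_insert fun h => p.notMem_σ htτ (Finset.mem_of_mem_erase h),
      ← Finset.mul_prod_erase p.σ (fun j => (X j : MvPolynomial (Fin r) K)) p.maxσ_mem]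
    ring

end

/-! ### Reduced elements -/

/-- The element `x^a [σ, τ]` is reduced if every variable `x_j` dividing `x^a` with `j ∉ σ` and
`j < max σ` satisfies `j ≤ max τ`. For `τ = ∅` this says that no such variable divides `x^a`;
for `τ ≠ ∅` it says that, among these indices and those of `τ`, the largest lies in `τ`. -/
def Reduced {r k i : ℕ} (p : Label r k i) (a : Fin r →₀ ℕ) : Prop :=
  ∀ j, a j ≠ 0 → j ∉ p.σ → j < p.maxσ → ∃ l ∈ p.τ, j ≤ l

/-- The elements of `F_i` all of whose terms `c x^a [σ, τ]` are reduced. -/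
def reducedSubgroup (K : Type*) [Field K] (r k i : ℕ) : AddSubgroup (FreeMod K r k i) where
  carrier := {x | ∀ p a, coeff a (x p) ≠ 0 → Reduced p a}
  zero_mem' := fun p a h => absurd (coeff_zero a) h
  add_mem' := by
    intro x y hx hy p a h
    rw [Finsupp.add_apply, coeff_add] at h
    by_cases hxa : coeff a (x p) = 0
    · rw [hxa, zero_add] at h
      exact hy p a h
    · exact hx p a hxa
  neg_mem' := by
    intro x hx p a h
    rw [Finsupp.neg_apply, coeff_neg] at h
    exact hx p a (neg_ne_zero.1 h)

/-- The position of the set `σ` in the filtration of the complex: the sum of its elements. The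
exchange part of the differential lowers it. -/
def weight {r : ℕ} (σ : Finset (Fin r)) : ℕ := ∑ j ∈ σ, (j : ℕ)

theorem Label.weight_exchange_lt {r k i : ℕ} (p : Label r k i) {j : Fin r} (hj : j ∈ p.τ) :
    weight (insert j (p.σ.erase p.maxσ)) < weight p.σ := by
  rw [weight, weight, Finset.sum_insert fun h => p.notMem_σ hj (Finset.mem_of_mem_erase h),
    ← Finset.add_sum_erase p.σ (fun j : Fin r => (j : ℕ)) p.maxσ_mem]
  exact Nat.add_lt_add_right (p.lt_maxσ hj) _

section

variable (K : Type*) [Field K] {r k i : ℕ}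

theorem single_monomial_mem_reducedSubgroup {p : Label r k i} {a : Fin r →₀ ℕ}
    (h : Reduced p a) (c : K) :
    Finsupp.single p (monomial a c) ∈ reducedSubgroup K r k i := by
  classical
  intro q b hb
  rw [Finsupp.single_apply] at hb
  split_ifs at hb with hpq
  · subst hpq
    rw [coeff_monomial] at hb
    split_ifs at hb with hab
    · exact hab ▸ h
    · exact absurd rfl hb
  · exact absurd (coeff_zero b) hb

theorem exists_max_of_not_reduced {p : Label r k i} {a : Fin r →₀ ℕ} (h : ¬ Reduced p a) :
    ∃ t, a t ≠ 0 ∧ t ∉ p.σ ∧ t < p.maxσ ∧ (∀ l ∈ p.τ, l < t) ∧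
      ∀ j, a j ≠ 0 → j ∉ p.σ → j < p.maxσ → j ≤ t := by
  classical
  rw [Reduced] at h
  push Not at h
  obtain ⟨s, hs⟩ := h
  obtain ⟨t, ht, hmax⟩ := Finset.exists_max_image
    (Finset.univ.filter fun j => a j ≠ 0 ∧ j ∉ p.σ ∧ j < p.maxσ) id
    ⟨s, Finset.mem_filter.2 ⟨Finset.mem_univ _, hs.1, hs.2.1, hs.2.2.1⟩⟩
  have hle : ∀ j, a j ≠ 0 → j ∉ p.σ → j < p.maxσ → j ≤ t := fun j h1 h2 h3 =>
    hmax j (Finset.mem_filter.2 ⟨Finset.mem_univ _, h1, h2, h3⟩)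
  obtain ⟨-, h1, h2, h3⟩ := Finset.mem_filter.1 ht
  exact ⟨t, h1, h2, h3, fun l hl => (hs.2.2.2 l hl).trans_le (hle s hs.1 hs.2.1 hs.2.2.1), hle⟩

/-- If `t` is the largest index at which `x^a [σ, τ]` fails to be reduced, then the boundary of
`-x^b [σ, τ + t]`, where `x^a = x_t x^b`, is `x^a [σ, τ]` up to reduced terms and terms of lower
weight. -/
theorem single_monomial_mem_sup (p : Label r k i) (a : Fin r →₀ ℕ) (c : K)
    (ih : ∀ (q : Label r k i) (f : MvPolynomial (Fin r) K), weight q.σ < weight p.σ →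
      Finsupp.single q f ∈
        (LinearMap.range (boundary K r k i)).toAddSubgroup ⊔ reducedSubgroup K r k i) :
    Finsupp.single p (monomial a c) ∈
      (LinearMap.range (boundary K r k i)).toAddSubgroup ⊔ reducedSubgroup K r k i := by
  by_cases hred : Reduced p a
  · exact AddSubgroup.mem_sup_right (single_monomial_mem_reducedSubgroup K hred c)
  obtain ⟨t, hat, htσ, htm, hτ, hle⟩ := exists_max_of_not_reduced hred
  have htτ : t ∉ p.τ := fun h => lt_irrefl _ (hτ t h)
  have hP : IsLabel k (i + 1) p.σ (insert t p.τ) := by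
    refine isLabel_iff.2 ⟨Finset.disjoint_insert_right.2 ⟨htσ, p.isLabel.1⟩, p.isLabel.2.1, ?_,
      p.maxσ, p.maxσ_mem, ?_⟩
    · rw [Finset.card_insert_of_notMem htτ, p.isLabel.2.2.1]
    · intro l hl
      rcases Finset.mem_insert.1 hl with rfl | hl
      · exact htm
      · exact p.lt_maxσ hl
  set P : Label r k (i + 1) := ⟨p.σ, insert t p.τ, hP⟩ with hPdef
  have hPm : P.maxσ = p.maxσ := rfl
  set b := a - Finsupp.single t 1 with hb
  have hab : b + Finsupp.single t 1 = a :=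
    tsub_add_cancel_of_le (Finsupp.single_le_iff.2 (Nat.one_le_iff_ne_zero.2 hat))
  have hsgn : sgn t (insert t p.τ) = 0 := by
    rw [sgn, Finset.card_eq_zero, Finset.filter_eq_empty_iff]
    intro l hl
    rcases Finset.mem_insert.1 hl with rfl | hl
    · exact lt_irrefl _
    · exact not_lt.2 (hτ l hl).le
  have hexch : ∀ j ∈ insert t p.τ, ∀ f : MvPolynomial (Fin r) K,
      f • gen K k i (insert j (p.σ.erase p.maxσ)) ((insert t p.τ).erase j) ∈
        (LinearMap.range (boundary K r k i)).toAddSubgroup ⊔ reducedSubgroup K r k i := by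
    intro j hj f
    by_cases hl : IsLabel k i (insert j (p.σ.erase p.maxσ)) ((insert t p.τ).erase j)
    · rw [gen_of_isLabel K hl, Finsupp.smul_single, smul_eq_mul, mul_one]
      exact ih _ _ (P.weight_exchange_lt hj)
    · rw [gen_of_not_isLabel K hl, smul_zero]
      exact zero_mem _
  have hkos : ∀ j ∈ p.τ, ∀ c : K,
      (monomial (b + Finsupp.single j 1) c : MvPolynomial (Fin r) K) •
        gen K k i p.σ ((insert t p.τ).erase j) ∈ reducedSubgroup K r k i := by
    intro j hj c
    have hl := P.isLabel_erase (Finset.mem_insert_of_mem hj)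
    rw [gen_of_isLabel K hl, Finsupp.smul_single, smul_eq_mul, mul_one]
    refine single_monomial_mem_reducedSubgroup K (fun l h1 h2 h3 => ?_) c
    refine ⟨t, Finset.mem_erase.2 ⟨(hτ j hj).ne', Finset.mem_insert_self _ _⟩, ?_⟩
    by_cases hlj : l = j
    · exact hlj ▸ (hτ j hj).le
    · refine hle l (fun h => h1 ?_) h2 h3
      rw [Finsupp.add_apply, Finsupp.single_eq_of_ne hlj, add_zero, hb, Finsupp.tsub_apply, h,
        zero_tsub]
  have hbd : boundary K r k i (Finsupp.single P (monomial b c)) ∈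
      (LinearMap.range (boundary K r k i)).toAddSubgroup ⊔ reducedSubgroup K r k i :=
    AddSubgroup.mem_sup_left ⟨_, rfl⟩
  have hsplit : boundary K r k i (Finsupp.single P (monomial b c)) =
      -Finsupp.single p (monomial a c) +
      ∑ j ∈ p.τ, -((monomial (b + Finsupp.single j 1) ((-1) ^ sgn j (insert t p.τ) * c) :
        MvPolynomial (Fin r) K) • gen K k i p.σ ((insert t p.τ).erase j)) +
      ∑ j ∈ insert t p.τ, (monomial b c * (-1) ^ sgn j (insert t p.τ) * X p.maxσ :
        MvPolynomial (Fin r) K) •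
          gen K k i (insert j (p.σ.erase p.maxσ)) ((insert t p.τ).erase j) := by
    have hmon : ∀ (j : Fin r) (n : ℕ), (monomial (b + Finsupp.single j 1) ((-1) ^ n * c) :
        MvPolynomial (Fin r) K) = monomial b c * (-1) ^ n * X j := by
      intro j n
      have : ((-1) ^ n : MvPolynomial (Fin r) K) = C ((-1) ^ n) := by simp
      rw [this, mul_comm (monomial b c), C_mul_monomial, X, monomial_mul, mul_one]
    have hlead : (Finsupp.single p (monomial a c) : FreeMod K r k i) =
        (monomial b c * (-1) ^ sgn t (insert t p.τ) * X t : MvPolynomial (Fin r) K) •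
          gen K k i p.σ ((insert t p.τ).erase t) := by
      rw [← hmon, Finset.erase_insert htτ, gen_label, Finsupp.smul_single, smul_eq_mul, mul_one,
        hab, hsgn, pow_zero, one_mul]
    simp only [hmon]
    rw [hlead, boundary_single, boundaryGen_eq_sum, Finset.smul_sum, Finset.sum_neg_distrib,
      ← neg_add, ← Finset.sum_insert (f := fun j =>
        (monomial b c * (-1) ^ sgn j (insert t p.τ) * X j : MvPolynomial (Fin r) K) •
          gen K k i p.σ ((insert t p.τ).erase j)) htτ, ← Finset.sum_neg_distrib,
      ← Finset.sum_add_distrib]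
    refine Finset.sum_congr rfl fun j hj => ?_
    rw [hPm]
    module
  have hsolve : Finsupp.single p (monomial a c) =
      ∑ j ∈ p.τ, -((monomial (b + Finsupp.single j 1) ((-1) ^ sgn j (insert t p.τ) * c) :
        MvPolynomial (Fin r) K) • gen K k i p.σ ((insert t p.τ).erase j)) +
      ∑ j ∈ insert t p.τ, (monomial b c * (-1) ^ sgn j (insert t p.τ) * X p.maxσ :
        MvPolynomial (Fin r) K) •
          gen K k i (insert j (p.σ.erase p.maxσ)) ((insert t p.τ).erase j) -
      boundary K r k i (Finsupp.single P (monomial b c)) := by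
    rw [hsplit]
    abel
  rw [hsolve]
  exact sub_mem (add_mem (sum_mem fun j hj => neg_mem (AddSubgroup.mem_sup_right (hkos j hj _)))
    (sum_mem fun j hj => hexch j hj _)) hbd

theorem single_mem_sup (n : ℕ) : ∀ (p : Label r k i) (f : MvPolynomial (Fin r) K),
    weight p.σ = n → Finsupp.single p f ∈
      (LinearMap.range (boundary K r k i)).toAddSubgroup ⊔ reducedSubgroup K r k i := by
  induction n using Nat.strong_induction_on with
  | _ n ih =>
    rintro p f rfl
    induction f using MvPolynomial.induction_on' with
    | monomial a c => exact single_monomial_mem_sup K p a c fun q g hq => ih _ hq q g rfl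
    | add f g hf hg =>
      rw [Finsupp.single_add]
      exact add_mem hf hg

/-- Every element of `F_i` is reduced modulo boundaries. -/
theorem exists_boundary_add_reduced (x : FreeMod K r k i) :
    ∃ y, ∃ n ∈ reducedSubgroup K r k i, boundary K r k i y + n = x := by
  have hx : x ∈ (LinearMap.range (boundary K r k i)).toAddSubgroup ⊔ reducedSubgroup K r k i := by
    induction x using Finsupp.induction_linear with
    | zero => exact zero_mem _
    | add x y hx hy => exact add_mem hx hy
    | single p f => exact single_mem_sup K _ p f rfl
  obtain ⟨_, ⟨y, rfl⟩, n, hn, h⟩ := AddSubgroup.mem_sup.1 hx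
  exact ⟨y, n, hn, h⟩

/-! ### The differential and the augmentation on reduced elements -/

/-- Take a term `c x^a [σ, τ]` of `n` with `σ` of maximal weight. The coefficient of
`x^a x_t [σ, τ - t]`, where `t = max τ`, in the boundary of `n` is then `-c`: terms with another
first set cannot contribute, and those with the same first set that could are not reduced. -/
theorem eq_zero_of_boundary_eq_zero {n : FreeMod K r k (i + 1)}
    (hn : n ∈ reducedSubgroup K r k (i + 1)) (h : boundary K r k i n = 0) : n = 0 := by
  classical
  by_contra hne
  obtain ⟨p, hp, hmax⟩ := Finset.exists_max_image n.support (fun p => weight p.σ)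
    (Finsupp.support_nonempty_iff.2 hne)
  obtain ⟨a, ha⟩ := MvPolynomial.ne_zero_iff.1 (Finsupp.mem_support_iff.1 hp)
  set t := p.maxτ with ht
  have htτ : t ∈ p.τ := p.maxτ_mem
  set q : Label r k i := ⟨p.σ, p.τ.erase t, p.isLabel_erase htτ⟩ with hq
  have hcoeff : coeff (a + Finsupp.single t 1) (boundary K r k i n q) = -coeff a (n p) := by
    rw [boundary, Finsupp.linearCombination_apply, Finsupp.sum, Finsupp.finsetSum_apply,
      coeff_sum, Finset.sum_eq_single_of_mem p hp]
    · rw [Finsupp.smul_apply, boundaryGen_apply_erase K htτ rfl rfl, sgn_maxτ, pow_zero, one_mul,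
        smul_eq_mul, mul_neg, coeff_neg, coeff_mul_X]
    · intro p' hp' hpp'
      rw [Finsupp.smul_apply, smul_eq_mul]
      by_cases h0 : boundaryGen K p' q = 0
      · rw [h0, mul_zero, coeff_zero]
      obtain ⟨j, hj, h2, h1 | h1⟩ := exists_of_boundaryGen_apply_ne_zero K h0
      · rw [boundaryGen_apply_erase K hj h1 h2, mul_left_comm, coeff_neg_one_pow_mul, mul_neg,
          coeff_neg, coeff_mul_X']
        have hσ : p.σ = p'.σ := h1
        have hτ : p.τ.erase t = p'.τ.erase j := h2
        have hjt : j ≠ t := by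
          rintro rfl
          refine hpp' (Label.ext_sets hσ.symm ?_)
          rw [← Finset.insert_erase hj, ← hτ, Finset.insert_erase htτ]
        have htτ' : t ∉ p'.τ := fun h =>
          Finset.notMem_erase t p.τ (hτ ▸ Finset.mem_erase.2 ⟨hjt.symm, h⟩)
        have hjm : j < p.maxσ := by
          have := p'.lt_maxσ hj
          rwa [Label.maxσ_eq p' (hσ ▸ p.maxσ_mem) fun s hs => p.le_maxσ (hσ ▸ hs)] at this
        split_ifs with hja
        · have haj : a j ≠ 0 := by
            rwa [Finsupp.mem_support_iff, Finsupp.add_apply, Finsupp.single_eq_of_ne hjt,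
              add_zero] at hja
          -- A contributing term of `n` at `[σ, τ - t + j]` is divisible by `x_t`, and `t > j` is
          -- above all of `τ - t + j`, so it is not reduced.
          by_contra hcon
          have hred := hn p' _ (fun h => hcon (by rw [h, neg_zero, mul_zero]))
          obtain ⟨l, hl, hjl⟩ := hn p a ha j haj (hσ ▸ p'.notMem_σ hj) hjm
          have hjt' : j < t := lt_of_le_of_ne (hjl.trans (p.le_maxτ hl)) hjt
          obtain ⟨l', hl', htl⟩ := hred t (by
            rw [Finsupp.tsub_apply, Finsupp.add_apply, Finsupp.single_eq_same,
              Finsupp.single_eq_of_ne hjt.symm]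
            omega) (hσ ▸ p.notMem_σ htτ) (by
            rw [Label.maxσ_eq p' (hσ ▸ p.maxσ_mem) fun s hs => p.le_maxσ (hσ ▸ hs)]
            exact p.lt_maxσ htτ)
          by_cases hlj : l' = j
          · exact absurd (hlj ▸ htl) (not_le.2 hjt')
          · have hl2 : l' ∈ p.τ.erase t := hτ ▸ Finset.mem_erase.2 ⟨hlj, hl'⟩
            rw [Finset.mem_erase] at hl2
            exact hl2.1 (le_antisymm (p.le_maxτ hl2.2) htl)
        · rw [neg_zero, mul_zero]
      · -- An exchange would start from a term of larger weight.
        have hlt := p'.weight_exchange_lt hj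
        rw [← h1] at hlt
        exact absurd (hmax p' hp') (not_le.2 hlt)
  rw [h] at hcoeff
  exact ha (neg_eq_zero.1 hcoeff.symm)

/-- The set `σ` consists of the `k` smallest variables dividing `x^a x_σ`, if `x^a [σ, ∅]` is
reduced. -/
theorem Label.subset_of_reduced {p q : Label r k 0} {a b : Fin r →₀ ℕ} (hq : Reduced q b)
    (h : a + p.deg = b + q.deg) (hpq : p.maxσ ≤ q.maxσ) : p.σ ⊆ q.σ := by
  have hdeg : ∀ (p : Label r k 0) (j : Fin r), p.deg j = if j ∈ p.σ then 1 else 0 := by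
    intro p j
    rw [Label.deg, Finset.card_eq_zero.1 p.isLabel.2.2.1, Finset.union_empty,
      Finsupp.finsetSum_apply]
    simp [Finsupp.single_apply]
  have hempty : q.τ = ∅ := Finset.card_eq_zero.1 q.isLabel.2.2.1
  intro j hj
  by_contra hjq
  have h1 := DFunLike.congr_fun h j
  rw [Finsupp.add_apply, Finsupp.add_apply, hdeg, hdeg, if_pos hj, if_neg hjq] at h1
  have hjm : j < q.maxσ := lt_of_le_of_ne ((p.le_maxσ hj).trans hpq)
    fun h => hjq (h ▸ q.maxσ_mem)
  obtain ⟨l, hl, -⟩ := hq j (by omega) hjq hjm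
  simp [hempty] at hl

theorem Label.eq_of_reduced {p q : Label r k 0} {a b : Fin r →₀ ℕ} (hp : Reduced p a)
    (hq : Reduced q b) (h : a + p.deg = b + q.deg) : p = q := by
  have hτ : p.τ = q.τ := by
    rw [Finset.card_eq_zero.1 p.isLabel.2.2.1, Finset.card_eq_zero.1 q.isLabel.2.2.1]
  refine Label.ext_sets ?_ hτ
  rcases le_total p.maxσ q.maxσ with hpq | hpq
  · exact Finset.eq_of_subset_of_card_le (subset_of_reduced hq h hpq)
      (by rw [p.isLabel.2.1, q.isLabel.2.1])
  · exact (Finset.eq_of_subset_of_card_le (subset_of_reduced hp h.symm hpq)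
      (by rw [p.isLabel.2.1, q.isLabel.2.1])).symm

theorem prod_X_eq_monomial_deg (p : Label r k 0) :
    ∏ j ∈ p.σ, (X j : MvPolynomial (Fin r) K) = monomial p.deg 1 := by
  rw [Label.deg, Finset.card_eq_zero.1 p.isLabel.2.2.1, Finset.union_empty, monomial_sum_one]
  rfl

/-- The monomials `x^a x_σ` with `x^a [σ, ∅]` reduced are pairwise different. -/
theorem eq_zero_of_augmentation_eq_zero {n : FreeMod K r k 0}
    (hn : n ∈ reducedSubgroup K r k 0) (h : augmentation K r k n = 0) : n = 0 := by
  classical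
  by_contra hne
  obtain ⟨p, hp⟩ := Finsupp.support_nonempty_iff.2 hne
  obtain ⟨a, ha⟩ := MvPolynomial.ne_zero_iff.1 (Finsupp.mem_support_iff.1 hp)
  have hcoeff : coeff (a + p.deg) (augmentation K r k n : MvPolynomial (Fin r) K) =
      coeff a (n p) := by
    rw [coe_augmentation, Finsupp.sum, coeff_sum, Finset.sum_eq_single_of_mem p hp]
    · rw [prod_X_eq_monomial_deg, coeff_mul_monomial, mul_one]
    · intro q hq hqp
      rw [prod_X_eq_monomial_deg, coeff_mul_monomial', mul_one]
      split_ifs with hle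
      · by_contra hcon
        exact hqp (Label.eq_of_reduced (hn p a ha) (hn q _ hcon)
          (tsub_add_cancel_of_le hle).symm).symm
      · rfl
  rw [h] at hcoeff
  exact ha hcoeff.symm

/-! ### Exactness -/

theorem exact_boundary_boundary (i : ℕ) :
    Function.Exact (boundary K r k (i + 1)) (boundary K r k i) := by
  intro x
  constructor
  · intro hx
    obtain ⟨y, n, hn, rfl⟩ := exists_boundary_add_reduced K x
    rw [map_add, boundary_comp_boundary, zero_add] at hx
    exact ⟨y, by rw [eq_zero_of_boundary_eq_zero K hn hx, add_zero]⟩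
  · rintro ⟨y, rfl⟩
    exact boundary_comp_boundary K y

theorem exact_boundary_augmentation :
    Function.Exact (boundary K r k 0) (augmentation K r k) := by
  intro x
  constructor
  · intro hx
    obtain ⟨y, n, hn, rfl⟩ := exists_boundary_add_reduced K x
    rw [map_add, augmentation_comp_boundary, zero_add] at hx
    exact ⟨y, by rw [eq_zero_of_augmentation_eq_zero K hn hx, add_zero]⟩
  · rintro ⟨y, rfl⟩
    exact augmentation_comp_boundary K y

theorem augmentation_surjective (hk : 1 ≤ k) : Function.Surjective (augmentation K r k) := by
  have hle : ideal K k r ≤ LinearMap.range ((ideal K k r).subtype ∘ₗ augmentation K r k) := by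
    refine Submodule.span_le.2 ?_
    rintro _ ⟨σ, hσ, rfl⟩
    obtain ⟨m, hm⟩ := Finset.card_pos.1 (hσ.symm ▸ hk : 0 < σ.card)
    have hl : IsLabel k 0 σ ∅ := isLabel_iff.2
      ⟨Finset.disjoint_empty_right _, hσ, Finset.card_empty, m, hm, by simp⟩
    exact ⟨_, augmentation_gen K hl⟩
  rintro ⟨f, hf⟩
  obtain ⟨x, hx⟩ := hle hf
  exact ⟨x, Subtype.ext hx⟩

theorem isMinimalFreeResolution (hk : 1 ≤ k) :
    IsMinimalFreeResolution (ideal K k r) (Label r k) (fun _ p => p.deg) (boundary K r k)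
      (augmentation K r k) where
  finite := Label.finite r k
  surjective := augmentation_surjective K hk
  exact_zero := exact_boundary_augmentation K
  exact_succ := exact_boundary_boundary K
  homogeneous_zero := by
    classical
    intro p e he
    rw [augmentation_single, one_mul, prod_X_eq_monomial_deg, coeff_monomial] at he
    by_contra hne
    exact he (if_neg fun h => hne h.symm)
  homogeneous_succ := by
    intro i p q e he
    rw [boundary_single, one_smul] at he
    exact boundaryGen_homogeneous K p q e he
  minimal := range_boundary_le K r k

end

end KOutOf

theorem mainTheorem2 (K : Type*) [Field K] (k r : ℕ) (hk : 1 ≤ k) (hkr : k ≤ r) :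
    KOutOf.IsMinimalFreeResolution (KOutOf.ideal K k r) (KOutOf.Label r k)
      (fun _ p => p.deg) (KOutOf.boundary K r k) (KOutOf.augmentation K r k) ∧
    (∀ i, r - k < i → IsEmpty (KOutOf.Label r k i)) ∧
    (∀ (i : ℕ) (p : KOutOf.Label r k (i + 1)), p.FirstCase →
      (KOutOf.boundary K r k i (Finsupp.single p 1)).support.card = 2 * p.τ.card) ∧
    (∀ (i : ℕ) (p : KOutOf.Label r k (i + 1)), p.SecondCase →
      (KOutOf.boundary K r k i (Finsupp.single p 1)).support.card = p.τ.card + 1) := by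
  refine ⟨KOutOf.isMinimalFreeResolution K hk, fun i hi => KOutOf.Label.isEmpty_of_lt hi,
    fun i p hp => ?_, fun i p hp => ?_⟩
  · rw [KOutOf.boundary_single, one_smul, KOutOf.card_support_of_firstCase K p hp]
  · rw [KOutOf.boundary_single, one_smul, KOutOf.card_support_of_secondCase K p hp]
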